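/- Let $p$ be a prime number and let $|\cdot|_p$ be the $p$-adic absolute value on $\mathbb{Q}_p$, normalized by $|p|_p=1/p$. Let $\beta\in\mathbb{Q}_p$ be quadratic over $\mathbb{Q}$, and let $f\in\mathbb{Z}[X]$ be an irreducible polynomial with $f(\beta)=0$. Then for every real number $\alpha$ with $f(\alpha)\neq 0$ the following hold. 1. The pair $(\alpha,\beta)$ satisfies condition (EK+): $$\inf_{\substack{q,r\in\mathbb{Z}\\ qr\neq 0}}\max\{|q|,|r|\}\,|q\alpha-r|\,|q\beta-r|_p=0.$$ 2. More precisely, over pairs of integers $(Q,R)$, $$\liminf_{\max\{|Q|,|R|\}\to+\infty}\max\{|Q|,|R|\}\,\log\max\{|Q|,|R|\}\,|Q\alpha-R|\,|Q\beta-R|_p<+\infty.$$ 3. There is a constant $C>0$, depending only on $p$, $\alpha$ and $\beta$, such that infinitely many pairs of integers $(Q,R)\ne(0,0)$ satisfy both $$|Q\alpha-R|\,\log\max\{|Q|,|R|\}\le C\max\{|Q|,|R|\}\quad\text{and}\quad |Q\beta-R|_p\le C\max\{|Q|,|R|\}^{-2}.$$ -/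

import Mathlib

noncomputable section

/-- The height `max {|Q|, |R|}` of a pair of integers. -/
def pairHeight (x : ℤ × ℤ) : ℝ := max |(x.1 : ℝ)| |(x.2 : ℝ)|

/-- The product `max {|Q|, |R|} * |Q α - R| * |Q β - R|_p`, where `|·|_p` is normalized
by `|p|_p = 1 / p`. -/
def multApprox (p : ℕ) [Fact p.Prime] (α : ℝ) (β : ℚ_[p]) (x : ℤ × ℤ) : ℝ :=
  pairHeight x * |(x.1 : ℝ) * α - (x.2 : ℝ)| * ‖(x.1 : ℚ_[p]) * β - (x.2 : ℚ_[p])‖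

/-- Condition (EK+): the infimum of `max {|q|, |r|} * |q α - r| * |q β - r|_p` over all pairs
of integers with `q r ≠ 0` equals `0`. -/
def EKPlus (p : ℕ) [Fact p.Prime] (α : ℝ) (β : ℚ_[p]) : Prop :=
  IsGLB (multApprox p α β '' {x : ℤ × ℤ | x.1 * x.2 ≠ 0}) 0

end

/-! The height of a pair `(Q, R)` with `|Q β - R|_p` of order `max {|Q|, |R|} ^ (-2)` is as small as
the pigeonhole principle allows, so one asks how well the directions of such pairs approximate `α`.
Let `D` be the discriminant of `f`, a nonsquare integer which has the square root
`δ = 2 a β + b` in `ℚ_[p]`. The pairs then correspond to elements `u + v √D` of `ℤ√D`, with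
`|Q β - R|_p = |u + v δ|_p` and `|Q α - R| = |u + v η|`, where `η = 2 a α + b` satisfies `η ^ 2 ≠ D`
(`exists_infinite_approx`).

The pairs come from the powers of one element. Since `p` splits in `ℚ(√D)`, some positive
power of a prime above `p` is principal. Instead of the finiteness of the class number, the proof
compares two elements of nearly minimal size that are highly divisible by this prime
(`zsqrtd_exists_norm_eq_pow`). If `ω` is the resulting generator and `N(ω) = S ^ 2`, then
`2 D ω ^ k` lies in `ℤ√D`, its `p`-adic size is at most `S ^ (-2 k)`, and its conjugates have product
of order `S ^ (2 k)` (`zsqrtd_exists_powers`).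

It remains to choose `k` such that `u + v η` is at most a constant times `S ^ k / k`; the logarithm
of the height is of order `k`. If `D < 0`, the argument of `ω ^ k` is `k θ`, and it has to be close
to a prescribed number modulo `π`. If `D > 0`, one may multiply by powers of a unit `ε` from Pell's
equation, and half the logarithm of the quotient of the two conjugates, which is linear in `k`, has
to be close to a prescribed number modulo `log ε`. In both cases the relevant slope is irrational,
because a rational one would make `ω` and its conjugate equal up to a unit after passing to a
power, whereas they have different sizes in `ℚ_[p]` (`zsqrtd_norm_map_eq_of_pow_eq`). So
inhomogeneous approximation with error `6 / k` applies (`exists_abs_mul_add_le_six_div`).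

This gives the third assertion. The second follows by multiplying the two bounds, and the
first follows from the second because the pairs found have `Q R ≠ 0` as soon as their height is
large (`mul_ne_zero_of_norm_le`). -/

/-! ### Inhomogeneous Diophantine approximation -/

/-- An irrational number has rational approximations `|θ - q| < 1 / q.den ^ 2` with arbitrarily
large denominators: only finitely many fractions with bounded denominator lie close to `θ`. -/
theorem exists_rat_abs_sub_lt_and_le_den {θ : ℝ} (hθ : Irrational θ) (N : ℕ) :
    ∃ q : ℚ, N ≤ q.den ∧ |θ - q| < 1 / (q.den : ℝ) ^ 2 := by
  by_contra! hcon
  refine Real.infinite_rat_abs_sub_lt_one_div_den_sq_of_irrational hθ ?_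
  obtain ⟨M, hM⟩ := exists_nat_ge ((|θ| + 1) * N)
  have hinj : Function.Injective (fun q : ℚ => (q.num, q.den)) := by
    intro a b hab
    simp only [Prod.mk.injEq] at hab
    exact Rat.ext hab.1 hab.2
  refine Set.Finite.of_finite_image (f := fun q : ℚ => (q.num, q.den)) ?_ hinj.injOn
  refine ((Set.finite_Icc (-(M : ℤ)) M).prod (Set.finite_Iic N)).subset ?_
  rintro _ ⟨q, hq, rfl⟩
  have hden : q.den < N := by
    by_contra! h
    exact absurd hq (not_lt.mpr (hcon q h))
  have hd1 : (1 : ℝ) ≤ q.den := by exact_mod_cast q.pos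
  have hq1 : |θ - q| < 1 := lt_of_lt_of_le hq (by
    rw [div_le_one (by positivity)]; nlinarith)
  have hq2 : |(q : ℝ)| ≤ |θ| + 1 := by
    have := abs_sub_abs_le_abs_sub (q : ℝ) θ
    rw [abs_sub_comm] at this
    linarith
  have hnum : |(q.num : ℝ)| ≤ M := by
    have h1 : (q.num : ℝ) = q * q.den := by exact_mod_cast (Rat.mul_den_eq_num q).symm
    rw [h1, abs_mul, Nat.abs_cast]
    have : (q.den : ℝ) ≤ N := by exact_mod_cast hden.le
    refine le_trans ?_ hM
    gcongr
  have hnum' : |q.num| ≤ (M : ℤ) := by exact_mod_cast hnum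
  simp only [Set.mem_prod, Set.mem_Icc, Set.mem_Iic]
  exact ⟨abs_le.mp hnum', hden.le⟩

/-- One-sided inhomogeneous approximation: for irrational `θ`, the fractional parts of `k θ` come
within `6 / k` of any prescribed number for arbitrarily large positive `k`. -/
theorem exists_abs_mul_add_le_six_div {θ : ℝ} (hθ : Irrational θ) (x : ℝ) (N : ℕ) :
    ∃ k : ℕ, N ≤ k ∧ 0 < k ∧ ∃ l : ℤ, |k * θ + l + x| ≤ 6 / k := by
  obtain ⟨a, hden, ha⟩ := exists_rat_abs_sub_lt_and_le_den hθ N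
  set q : ℕ := a.den with hq
  have hq0 : 0 < q := a.pos
  have hq0' : (0 : ℝ) < q := by exact_mod_cast hq0
  have hqz : (0 : ℤ) < q := by exact_mod_cast hq0
  set r : ℤ := round (-(q * x)) with hr
  have hrx : |q * x + r| ≤ 1 / 2 := by
    have h := abs_sub_round (-(q * x))
    rwa [← abs_neg, show -(-(q * x) - (r : ℝ)) = q * x + r by ring] at h
  -- As `a.num` is invertible modulo `q`, some `k` in `[q, 2 q)` has `k * a.num ≡ r` modulo `q`.
  have hcop : IsCoprime (a.num) (q : ℤ) := by
    rw [Int.isCoprime_iff_nat_coprime]; simpa using a.reduced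
  obtain ⟨s, t, hst⟩ := hcop
  set j : ℤ := (r * s) % q with hj
  have hj0 : 0 ≤ j := Int.emod_nonneg _ hqz.ne'
  have hj1 : j < q := Int.emod_lt_of_pos _ hqz
  obtain ⟨k, hk⟩ := Int.eq_ofNat_of_zero_le (show 0 ≤ (q : ℤ) + j by omega)
  have hkq : q ≤ k := by omega
  have hk2 : k < 2 * q := by omega
  have hdvd : (q : ℤ) ∣ r - k * a.num := by
    have h1 : (q : ℤ) ∣ r * s - j := Int.dvd_self_sub_emod
    obtain ⟨c, hc⟩ := h1
    refine ⟨r * t + c * a.num - a.num, ?_⟩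
    have hk' : (k : ℤ) = q + j := hk.symm
    rw [hk']
    linear_combination (-r) * hst + a.num * hc
  obtain ⟨l, hl⟩ := hdvd
  refine ⟨k, hden.trans hkq, by omega, l, ?_⟩
  have hk0' : (0 : ℝ) < k := by exact_mod_cast (by omega : 0 < k)
  have hk2' : (k : ℝ) ≤ 2 * q := by exact_mod_cast hk2.le
  have hnum : (a : ℝ) * q = a.num := by exact_mod_cast Rat.mul_den_eq_num a
  have hlR : (r : ℝ) - k * a.num = q * l := by exact_mod_cast hl
  have key : k * θ + l + x = k * (θ - a) + (q * x + r) / q := by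
    field_simp
    linear_combination (-1 : ℝ) * hlR + k * hnum
  have h1 : |k * (θ - a)| ≤ 2 / q := by
    rw [abs_mul, Nat.abs_cast]
    calc (k : ℝ) * |θ - a| ≤ (2 * q) * (1 / (q : ℝ) ^ 2) := by gcongr
      _ = 2 / q := by field_simp
  have h2 : |(q * x + r) / q| ≤ 1 / q := by
    rw [abs_div, Nat.abs_cast]
    gcongr
    linarith
  calc |k * θ + l + x| ≤ 2 / q + 1 / q := by
        rw [key]; exact (abs_add_le _ _).trans (add_le_add h1 h2)
    _ = 6 / (2 * q) := by field_simp; norm_num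
    _ ≤ 6 / k := by gcongr

/-! ### Elements of `ℤ√D` of controlled `p`-adic size -/

theorem zsqrtd_map_eq {R : Type*} [CommRing R] {D : ℤ} (φ : ℤ√D →+* R) (z : ℤ√D) :
    φ z = z.re + z.im * φ Zsqrtd.sqrtd := by
  have h := congrArg φ (Zsqrtd.decompose (d := D) (x := z.re) (y := z.im))
  simpa [mul_comm] using h

theorem zsqrtd_map_sqrtd_mul_self {R : Type*} [CommRing R] {D : ℤ} (φ : ℤ√D →+* R) :
    φ Zsqrtd.sqrtd * φ Zsqrtd.sqrtd = D := by
  rw [← map_mul, Zsqrtd.dmuld, map_intCast]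

theorem zsqrtd_map_mul_map_star {R : Type*} [CommRing R] {D : ℤ} (φ : ℤ√D →+* R) (z : ℤ√D) :
    φ z * φ (star z) = z.norm := by
  rw [← map_mul, ← Zsqrtd.norm_eq_mul_conj, map_intCast]

section padic

variable {p : ℕ} [Fact p.Prime] {D : ℤ} (φ : ℤ√D →+* ℚ_[p])

theorem zsqrtd_norm_map_sqrtd_le_one : ‖φ Zsqrtd.sqrtd‖ ≤ 1 := by
  have h := congrArg (‖·‖) (zsqrtd_map_sqrtd_mul_self φ)
  simp only [norm_mul] at h
  have h2 := Padic.norm_int_le_one (p := p) D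
  by_contra! h3
  nlinarith

theorem zsqrtd_norm_map_le_one (z : ℤ√D) : ‖φ z‖ ≤ 1 := by
  rw [zsqrtd_map_eq φ z]
  refine (IsUltrametricDist.norm_add_le_max _ _).trans (max_le (Padic.norm_int_le_one _) ?_)
  rw [norm_mul]
  exact mul_le_one₀ (Padic.norm_int_le_one _) (norm_nonneg _) (zsqrtd_norm_map_sqrtd_le_one φ)

theorem zsqrtd_norm_map_eq_one_of_norm_eq_one {z : ℤ√D} (hz : z.norm = 1) : ‖φ z‖ = 1 := by
  have h := congrArg (‖·‖) (zsqrtd_map_mul_map_star φ z)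
  simp only [norm_mul, hz, Int.cast_one, norm_one] at h
  nlinarith [zsqrtd_norm_map_le_one φ z, zsqrtd_norm_map_le_one φ (star z), norm_nonneg (φ z)]

/-- A `p`-adic analogue of Dirichlet's theorem, by the pigeonhole principle: there are nonzero
elements `u + v √D` with `|u|, |v| ≤ p ^ n` whose `p`-adic size is at most `p ^ (-2 n)`. -/
theorem zsqrtd_exists_norm_map_le (n : ℕ) : ∃ x : ℤ√D, x ≠ 0 ∧ |x.re| ≤ (p : ℤ) ^ n ∧
    |x.im| ≤ (p : ℤ) ^ n ∧ ‖φ x‖ ≤ (p : ℝ) ^ (-((2 * n : ℕ) : ℤ)) := by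
  have hp : 0 < p := (Fact.out : p.Prime).pos
  let d : ℤ_[p] := ⟨φ Zsqrtd.sqrtd, zsqrtd_norm_map_sqrtd_le_one φ⟩
  let r : ℕ := d.appr (2 * n)
  have hr : ‖φ Zsqrtd.sqrtd - r‖ ≤ (p : ℝ) ^ (-((2 * n : ℕ) : ℤ)) := by
    have h := (PadicInt.norm_le_pow_iff_mem_span_pow _ _).mpr (PadicInt.appr_spec (2 * n) d)
    rw [PadicInt.norm_def, PadicInt.coe_sub, PadicInt.coe_natCast] at h
    exact h
  have : NeZero (p ^ (2 * n)) := ⟨(pow_pos hp _).ne'⟩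
  let F : Fin (p ^ n + 1) × Fin (p ^ n + 1) → ZMod (p ^ (2 * n)) :=
    fun w => (w.1 : ℕ) + (w.2 : ℕ) * (r : ZMod (p ^ (2 * n)))
  obtain ⟨w, w', hne, heq⟩ := Fintype.exists_ne_map_eq_of_card_lt F (by
    rw [ZMod.card, Fintype.card_prod, Fintype.card_fin, two_mul, pow_add]
    exact Nat.mul_lt_mul'' (Nat.lt_succ_self _) (Nat.lt_succ_self _))
  have hbd : ∀ i j : Fin (p ^ n + 1), |((i : ℕ) : ℤ) - ((j : ℕ) : ℤ)| ≤ (p : ℤ) ^ n := by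
    intro i j
    have hi : ((i : ℕ) : ℤ) ≤ (p : ℤ) ^ n := by exact_mod_cast Nat.lt_succ_iff.mp i.2
    have hj : ((j : ℕ) : ℤ) ≤ (p : ℤ) ^ n := by exact_mod_cast Nat.lt_succ_iff.mp j.2
    rw [abs_le]; constructor <;> omega
  refine ⟨⟨((w.1 : ℕ) : ℤ) - ((w'.1 : ℕ) : ℤ), ((w.2 : ℕ) : ℤ) - ((w'.2 : ℕ) : ℤ)⟩, ?_,
    hbd _ _, hbd _ _, ?_⟩
  · intro h0
    rw [Zsqrtd.ext_iff] at h0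
    simp only [Zsqrtd.re_zero, Zsqrtd.im_zero] at h0
    apply hne
    ext <;> omega
  · set u : ℤ := ((w.1 : ℕ) : ℤ) - ((w'.1 : ℕ) : ℤ) with hu
    set v : ℤ := ((w.2 : ℕ) : ℤ) - ((w'.2 : ℕ) : ℤ) with hv
    have hdvd : (p : ℤ) ^ (2 * n) ∣ u + v * r := by
      have : ((u + v * r : ℤ) : ZMod (p ^ (2 * n))) = 0 := by
        simp only [F] at heq
        rw [hu, hv]
        push_cast
        linear_combination heq
      have := (ZMod.intCast_zmod_eq_zero_iff_dvd _ _).mp this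
      exact_mod_cast this
    have h1 := (Padic.norm_int_le_pow_iff_dvd (p := p) _ _).mpr hdvd
    rw [zsqrtd_map_eq]
    have : (u : ℚ_[p]) + v * φ Zsqrtd.sqrtd = ((u + v * r : ℤ) : ℚ_[p])
        + v * (φ Zsqrtd.sqrtd - r) := by push_cast; ring
    dsimp only
    rw [this]
    refine (IsUltrametricDist.norm_add_le_max _ _).trans (max_le h1 ?_)
    rw [norm_mul]
    calc _ ≤ 1 * ‖φ Zsqrtd.sqrtd - r‖ := by gcongr; exact Padic.norm_int_le_one _
      _ ≤ _ := by rwa [one_mul]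

/-- An element `x` of size `p ^ n` with `‖φ x‖ ≤ p ^ (-2 n)` has norm `p ^ (2 n) j` with `j`
bounded independently of `n`, because the norm is divisible by `p ^ (2 n)`. -/
theorem zsqrtd_exists_norm_eq_pow_mul (hD : ∀ n : ℤ, D ≠ n * n) {n : ℕ} {x : ℤ√D} (hx : x ≠ 0)
    (hre : |x.re| ≤ (p : ℤ) ^ n) (him : |x.im| ≤ (p : ℤ) ^ n)
    (hφ : ‖φ x‖ ≤ (p : ℝ) ^ (-((2 * n : ℕ) : ℤ))) :
    ∃ j : ℤ, j ≠ 0 ∧ |j| ≤ 1 + |D| ∧ x.norm = (p : ℤ) ^ (2 * n) * j := by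
  have hp : (0 : ℤ) < p := by exact_mod_cast (Fact.out : p.Prime).pos
  have hdvd : (p : ℤ) ^ (2 * n) ∣ x.norm := by
    rw [← Padic.norm_int_le_pow_iff_dvd (p := p), ← zsqrtd_map_mul_map_star φ, norm_mul]
    calc ‖φ x‖ * ‖φ (star x)‖ ≤ ‖φ x‖ * 1 := by
          gcongr; exact zsqrtd_norm_map_le_one φ _
      _ ≤ _ := by rwa [mul_one]
  obtain ⟨j, hj⟩ := hdvd
  refine ⟨j, ?_, ?_, hj⟩
  · rintro rfl
    rw [mul_zero] at hj
    exact hx ((Zsqrtd.norm_eq_zero hD x).mp hj)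
  · have hP : (0 : ℤ) < (p : ℤ) ^ (2 * n) := by positivity
    have h1 : |x.re| * |x.re| ≤ (p : ℤ) ^ (2 * n) := by
      rw [two_mul, pow_add]; gcongr
    have h2 : |x.im| * |x.im| ≤ (p : ℤ) ^ (2 * n) := by
      rw [two_mul, pow_add]; gcongr
    have h3 : |x.norm| ≤ |x.re| * |x.re| + |D| * (|x.im| * |x.im|) := by
      rw [Zsqrtd.norm_def]
      refine (abs_sub _ _).trans (le_of_eq ?_)
      rw [abs_mul, abs_mul, abs_mul]; ring
    rw [hj, abs_mul, abs_of_pos hP] at h3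
    have h4 : |D| * (|x.im| * |x.im|) ≤ |D| * (p : ℤ) ^ (2 * n) := by gcongr
    have h5 : (p : ℤ) ^ (2 * n) * |j| ≤ (p : ℤ) ^ (2 * n) * (1 + |D|) := by nlinarith
    exact le_of_mul_le_mul_left h5 hP

/-- There is an element `y` of `ℤ√D` whose norm is a power of `p` and which is divisible by
different powers of the two primes above `p`. In other words `y / p ^ (2 n)` generates a positive
power of one of these primes. It arises as a quotient of two of the elements of
`zsqrtd_exists_norm_map_le` which agree in finitely many respects. -/
theorem zsqrtd_exists_norm_eq_pow (hD : ∀ n : ℤ, D ≠ n * n) :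
    ∃ (n m : ℕ) (y : ℤ√D), n < m ∧ y.norm = (p : ℤ) ^ (2 * (m + n)) ∧
      ‖φ y‖ = (p : ℝ) ^ (-((2 * m : ℕ) : ℤ)) ∧ ‖φ (star y)‖ = (p : ℝ) ^ (-((2 * n : ℕ) : ℤ)) := by
  have hp1 : 1 < p := (Fact.out : p.Prime).one_lt
  have hp : (0 : ℝ) < p := by exact_mod_cast (Fact.out : p.Prime).pos
  choose x hx0 hre him hxφ using zsqrtd_exists_norm_map_le φ
  choose j hj0 hjb hj using
    fun n => zsqrtd_exists_norm_eq_pow_mul φ hD (hx0 n) (hre n) (him n) (hxφ n)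
  -- Every `p * j n` divides `J`, so residues modulo `J` determine residues modulo `p * j n`.
  let B : ℕ := (1 + |D|).toNat
  let J : ℕ := p * B.factorial
  have hJ0 : J ≠ 0 := mul_ne_zero (by omega) (Nat.factorial_ne_zero _)
  have : NeZero J := ⟨hJ0⟩
  have hdvdJ : ∀ n, (p : ℤ) * j n ∣ J := by
    intro n
    have h1 : (j n).natAbs ≤ B := by
      have := hjb n
      simp only [B]; rw [Int.abs_eq_natAbs] at this; omega
    have h2 : (j n).natAbs ∣ B.factorial :=
      Nat.dvd_factorial (Int.natAbs_pos.mpr (hj0 n)) h1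
    have h3 : j n ∣ (B.factorial : ℤ) := Int.natAbs_dvd.mp (by exact_mod_cast h2)
    simp only [J, Nat.cast_mul]
    exact mul_dvd_mul_left _ h3
  let F : ℕ → Set.Icc (-(1 + |D|)) (1 + |D|) × ZMod J × ZMod J :=
    fun n => (⟨j n, abs_le.mp (hjb n)⟩, ((x n).re : ZMod J), ((x n).im : ZMod J))
  obtain ⟨n, m, hnm, hF⟩ : ∃ n m, n < m ∧ F n = F m := by
    obtain ⟨a, b, hab, hF⟩ := Finite.exists_ne_map_eq_of_infinite F
    rcases lt_or_gt_of_ne hab with h | h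
    · exact ⟨a, b, h, hF⟩
    · exact ⟨b, a, h, hF.symm⟩
  simp only [F, Prod.mk.injEq] at hF
  obtain ⟨hjj, hre', him'⟩ := hF
  replace hjj : j n = j m := congrArg Subtype.val hjj
  have hcong : ((p * j n : ℤ) : ℤ√D) ∣ x m - x n := by
    rw [Zsqrtd.intCast_dvd]
    constructor
    · rw [Zsqrtd.re_sub]
      exact (hdvdJ n).trans ((ZMod.intCast_eq_intCast_iff_dvd_sub _ _ _).mp hre')
    · rw [Zsqrtd.im_sub]
      exact (hdvdJ n).trans ((ZMod.intCast_eq_intCast_iff_dvd_sub _ _ _).mp him')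
  obtain ⟨w, hw⟩ := hcong
  have hxm : x m = x n + ((p * j n : ℤ) : ℤ√D) * w := by rw [← hw]; ring
  let y : ℤ√D := ((p : ℤ) ^ (2 * n) : ℤ) + (p : ℤ) * w * star (x n)
  have hy : x m * star (x n) = (j n : ℤ√D) * y := by
    have h := Zsqrtd.norm_eq_mul_conj (x n)
    rw [hj n] at h
    simp only [y]
    rw [hxm, add_mul, ← h]
    push_cast
    ring
  have hjp : ‖((j n : ℤ) : ℚ_[p])‖ ≠ 0 := by
    rw [norm_ne_zero_iff]; exact_mod_cast hj0 n
  have hjpos : 0 < ‖((j n : ℤ) : ℚ_[p])‖ := lt_of_le_of_ne (norm_nonneg _) hjp.symm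
  have hprod : ∀ i, ‖φ (x i)‖ * ‖φ (star (x i))‖
      = (p : ℝ) ^ (-((2 * i : ℕ) : ℤ)) * ‖((j i : ℤ) : ℚ_[p])‖ := by
    intro i
    rw [← norm_mul, zsqrtd_map_mul_map_star, hj i, Int.cast_mul, norm_mul, Int.cast_pow,
      Int.cast_natCast, Padic.norm_p_pow]
  have hlow : ‖((j n : ℤ) : ℚ_[p])‖ ≤ ‖φ (star (x n))‖ := by
    have h1 := hprod n
    have h2 : 0 < (p : ℝ) ^ (-((2 * n : ℕ) : ℤ)) := by positivity
    have h3 : (p : ℝ) ^ (-((2 * n : ℕ) : ℤ)) * ‖((j n : ℤ) : ℚ_[p])‖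
        ≤ (p : ℝ) ^ (-((2 * n : ℕ) : ℤ)) * ‖φ (star (x n))‖ := by
      rw [← h1]
      exact mul_le_mul_of_nonneg_right (hxφ n) (norm_nonneg _)
    exact le_of_mul_le_mul_left h3 h2
  -- The conjugates of `x m` and `x n` differ by less than their `p`-adic size.
  have hstar : ‖φ (star (x m))‖ = ‖φ (star (x n))‖ := by
    apply Padic.norm_eq_of_norm_sub_lt_right
    refine lt_of_lt_of_le ?_ hlow
    rw [← map_sub, ← star_sub, hw, star_mul, star_intCast, map_mul, norm_mul, map_intCast,
      Int.cast_mul, norm_mul, Int.cast_natCast, Padic.norm_p]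
    have h1 := zsqrtd_norm_map_le_one φ (star w)
    have h2 : (p : ℝ)⁻¹ < 1 := inv_lt_one_of_one_lt₀ (by exact_mod_cast hp1)
    calc ‖φ (star w)‖ * ((p : ℝ)⁻¹ * ‖((j n : ℤ) : ℚ_[p])‖)
        ≤ 1 * ((p : ℝ)⁻¹ * ‖((j n : ℤ) : ℚ_[p])‖) := by gcongr
      _ < ‖((j n : ℤ) : ℚ_[p])‖ := by rw [one_mul]; nlinarith
  refine ⟨n, m, y, hnm, ?_, ?_, ?_⟩
  · have h := congrArg Zsqrtd.norm hy
    rw [Zsqrtd.norm_mul, Zsqrtd.norm_mul, Zsqrtd.norm_conj, hj m, hj n, Zsqrtd.norm_intCast,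
      ← hjj] at h
    refine mul_left_cancel₀ (mul_ne_zero (hj0 n) (hj0 n)) ?_
    rw [← h]; ring
  · have h := congrArg (fun t => ‖φ t‖) hy
    simp only [map_mul, norm_mul, map_intCast] at h
    rw [← hstar, hprod m, ← hjj, mul_comm] at h
    exact (mul_left_cancel₀ hjp h).symm
  · have h := congrArg (fun t => ‖φ (star t)‖) hy
    simp only [star_mul, star_star, map_mul, norm_mul, map_intCast, star_intCast] at h
    rw [hstar, hprod n, mul_comm] at h
    rw [mul_comm ‖φ (star y)‖] at h
    exact (mul_left_cancel₀ hjp h).symm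

/-- An element of `ℤ√D` with both `p`-adic images of size at most `p ^ (-n)` is divisible by
`p ^ n` after multiplication by the different `2 √D`, hence by `2 D`. -/
theorem zsqrtd_pow_dvd_two_mul {z : ℤ√D} {n : ℕ} (h1 : ‖φ z‖ ≤ (p : ℝ) ^ (-(n : ℤ)))
    (h2 : ‖φ (star z)‖ ≤ (p : ℝ) ^ (-(n : ℤ))) :
    (((p : ℤ) ^ n : ℤ) : ℤ√D) ∣ ((2 * D : ℤ) : ℤ√D) * z := by
  have e1 := zsqrtd_map_eq φ z
  have e2 := zsqrtd_map_eq φ (star z)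
  rw [Zsqrtd.re_star, Zsqrtd.im_star] at e2
  push_cast at e2
  have hD := zsqrtd_map_sqrtd_mul_self φ
  rw [Zsqrtd.intCast_dvd, Zsqrtd.re_smul, Zsqrtd.im_smul, ← Padic.norm_int_le_pow_iff_dvd,
    ← Padic.norm_int_le_pow_iff_dvd]
  constructor
  · have : ((2 * D * z.re : ℤ) : ℚ_[p]) = (D : ℚ_[p]) * (φ z + φ (star z)) := by
      push_cast; rw [e1, e2]; ring
    rw [this, norm_mul]
    calc _ ≤ 1 * ‖φ z + φ (star z)‖ := by gcongr; exact Padic.norm_int_le_one _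
      _ ≤ _ := by
        rw [one_mul]; exact (IsUltrametricDist.norm_add_le_max _ _).trans (max_le h1 h2)
  · have : ((2 * D * z.im : ℤ) : ℚ_[p]) = φ Zsqrtd.sqrtd * (φ z + - φ (star z)) := by
      push_cast; rw [e1, e2, ← hD]; ring
    rw [this, norm_mul]
    calc _ ≤ 1 * ‖φ z + - φ (star z)‖ := by gcongr; exact zsqrtd_norm_map_sqrtd_le_one φ
      _ ≤ _ := by
        rw [one_mul]
        exact (IsUltrametricDist.norm_add_le_max _ _).trans (max_le h1 (by rwa [norm_neg]))

/-- The sequence `z k` is, up to the factor `2 D`, the sequence of powers of `y / q`, an element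
of norm `S ^ 2` which is a unit at all primes but one of the two primes above `p`. So `z k` has
norm of order `S ^ (2 k)` and `p`-adic size at most `S ^ (-2 k)`. -/
theorem zsqrtd_exists_powers (hD : ∀ n : ℤ, D ≠ n * n) :
    ∃ (q : ℕ) (S : ℝ) (y : ℤ√D) (z : ℕ → ℤ√D), 0 < q ∧ 1 < S ∧ IsSquare y ∧
      (y.norm : ℝ) = (q * S) ^ 2 ∧ ‖φ y‖ ≠ ‖φ (star y)‖ ∧
      (∀ k, (q : ℤ√D) ^ k * z k = ((2 * D : ℤ) : ℤ√D) * y ^ k) ∧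
      ∀ k, ‖φ (z k)‖ * S ^ (2 * k) ≤ 1 := by
  obtain ⟨n, m, y, hnm, hy, h1, h2⟩ := zsqrtd_exists_norm_eq_pow φ hD
  have hp1 : (1 : ℝ) < p := by exact_mod_cast (Fact.out : p.Prime).one_lt
  have hp : (0 : ℝ) < p := by linarith
  have h1' : ∀ k : ℕ, ‖φ ((y * y) ^ k)‖ = (p : ℝ) ^ (-((4 * m * k : ℕ) : ℤ)) := by
    intro k
    rw [map_pow, map_mul, norm_pow, norm_mul, h1, ← zpow_add₀ hp.ne', ← zpow_natCast, ← zpow_mul]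
    congr 1; push_cast; ring
  have h2' : ∀ k : ℕ, ‖φ (star ((y * y) ^ k))‖ = (p : ℝ) ^ (-((4 * n * k : ℕ) : ℤ)) := by
    intro k
    rw [star_pow, star_mul, map_pow, map_mul, norm_pow, norm_mul, h2, ← zpow_add₀ hp.ne',
      ← zpow_natCast, ← zpow_mul]
    congr 1; push_cast; ring
  have hdvd : ∀ k : ℕ, ∃ z : ℤ√D,
      ((2 * D : ℤ) : ℤ√D) * (y * y) ^ k = (((p : ℤ) ^ (4 * n * k) : ℤ) : ℤ√D) * z := by
    intro k
    refine zsqrtd_pow_dvd_two_mul φ ?_ (h2' k).le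
    rw [h1']
    refine zpow_le_zpow_right₀ hp1.le (neg_le_neg ?_)
    exact_mod_cast Nat.mul_le_mul_right k (Nat.mul_le_mul_left 4 hnm.le)
  choose z hz using hdvd
  refine ⟨p ^ (4 * n), (p : ℝ) ^ (2 * (m - n)), y * y, z, ?_, ?_, ⟨y, rfl⟩, ?_, ?_, ?_, ?_⟩
  · exact pow_pos (Fact.out : p.Prime).pos _
  · exact one_lt_pow₀ hp1 (by omega)
  · rw [Zsqrtd.norm_mul, hy]
    push_cast
    rw [← pow_add, ← pow_add, ← pow_mul]
    congr 1; omega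
  · have e1 := h1' 1
    have e2 := h2' 1
    rw [pow_one] at e1 e2
    rw [e1, e2]
    intro h
    have := zpow_right_injective₀ hp hp1.ne' h
    omega
  · intro k
    rw [hz k]
    push_cast
    rw [← pow_mul]
  · intro k
    have h3 : ‖φ ((y * y) ^ k)‖ ≥ ‖((2 * D : ℤ) : ℚ_[p])‖ * ‖φ ((y * y) ^ k)‖ :=
      mul_le_of_le_one_left (norm_nonneg _) (Padic.norm_int_le_one _)
    rw [← norm_mul, ← map_intCast φ, ← map_mul, hz k, h1', map_mul, map_intCast, norm_mul,
      Int.cast_pow, Int.cast_natCast, Padic.norm_p_pow, ge_iff_le] at h3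
    have h4 : (0 : ℝ) < (p : ℝ) ^ (-((4 * m * k : ℕ) : ℤ)) := by positivity
    have h5 : (p : ℝ) ^ (-((4 * m * k : ℕ) : ℤ)) * ((p : ℝ) ^ (2 * (m - n))) ^ (2 * k)
        = (p : ℝ) ^ (-((4 * n * k : ℕ) : ℤ)) := by
      rw [← pow_mul, ← zpow_natCast, ← zpow_add₀ hp.ne']
      congr 1
      push_cast [Nat.cast_sub hnm.le]
      ring
    rw [← h5] at h3
    have h6 : (p : ℝ) ^ (-((4 * m * k : ℕ) : ℤ)) *
        (‖φ (z k)‖ * ((p : ℝ) ^ (2 * (m - n))) ^ (2 * k))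
        ≤ (p : ℝ) ^ (-((4 * m * k : ℕ) : ℤ)) * 1 := by
      rw [mul_one]; linarith
    exact le_of_mul_le_mul_left h6 h4

end padic

/-- The norms in the sequence of `zsqrtd_exists_powers`. -/
theorem zsqrtd_norm_powers {D : ℤ} {q : ℕ} {S : ℝ} {y z : ℤ√D} {k : ℕ} (hq : 0 < q)
    (hy : (y.norm : ℝ) = (q * S) ^ 2)
    (hz : (q : ℤ√D) ^ k * z = ((2 * D : ℤ) : ℤ√D) * y ^ k) :
    (z.norm : ℝ) = (2 * D) ^ 2 * S ^ (2 * k) := by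
  have h := congrArg (fun t => (Zsqrtd.normMonoidHom t : ℝ)) hz
  simp only [map_mul, map_pow] at h
  simp only [Zsqrtd.normMonoidHom, MonoidHom.coe_mk, OneHom.coe_mk, Zsqrtd.norm_intCast,
    Zsqrtd.norm_natCast] at h
  push_cast at h
  rw [hy] at h
  have hq' : (0 : ℝ) < ((q : ℝ) * q) ^ k := by positivity
  refine mul_left_cancel₀ hq'.ne' (h.trans ?_)
  ring

/-- If a unit of norm one times a power of `star y` equals that power of `y`, then `y` has the
same size at both primes above `p`. -/
theorem zsqrtd_norm_map_eq_of_pow_eq {p : ℕ} [Fact p.Prime] {D : ℤ} (φ : ℤ√D →+* ℚ_[p])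
    {y u : ℤ√D} {b : ℕ} (hb : b ≠ 0) (hu : u.norm = 1) (h : y ^ b = star y ^ b * u) :
    ‖φ y‖ = ‖φ (star y)‖ := by
  have h1 := congrArg (fun t => ‖φ t‖) h
  simp only [map_mul, norm_mul, zsqrtd_norm_map_eq_one_of_norm_eq_one φ hu, mul_one, map_pow,
    norm_pow] at h1
  exact (pow_left_inj₀ (norm_nonneg _) (norm_nonneg _) hb).mp h1

/-! ### Imaginary quadratic case -/

/-- For `D < 0` the elements `z k` have arguments `k θ` with `θ / π` irrational, and `u + v η` is a
linear form in `z = u + v √D` vanishing on one line through the origin, so inhomogeneous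
approximation makes it small. -/
theorem zsqrtd_exists_small_of_neg {p : ℕ} [Fact p.Prime] {D : ℤ} (φ : ℤ√D →+* ℚ_[p])
    (hD : D < 0) (η : ℝ) :
    ∃ C S : ℝ, 0 < C ∧ 1 < S ∧ ∀ N : ℕ, ∃ k ≥ N, ∃ z : ℤ√D,
      |(z.re : ℝ) + z.im * η| * k ≤ C * S ^ k ∧ ‖φ z‖ * S ^ (2 * k) ≤ 1 ∧
      |(z.re : ℝ)| ≤ C * S ^ k ∧ |(z.im : ℝ)| ≤ C * S ^ k ∧ S ^ (2 * k) ≤ |(z.norm : ℝ)| := by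
  have hD' : ∀ n : ℤ, D ≠ n * n := fun n h => by nlinarith [mul_self_nonneg n]
  obtain ⟨q, S, y, z, hq, hS, -, hy, hne, hz, hφ⟩ := zsqrtd_exists_powers φ hD'
  have hq' : (0 : ℝ) < q := by exact_mod_cast hq
  have hD1 : (1 : ℝ) ≤ -(D : ℝ) := by exact_mod_cast (by omega : 1 ≤ -D)
  set s : ℝ := √(-(D : ℝ)) with hs
  have hs2 : s * s = -D := Real.mul_self_sqrt (by linarith)
  have hs1 : 1 ≤ s := Real.one_le_sqrt.mpr hD1
  let ι : ℤ√D →+* ℂ := Zsqrtd.lift ⟨s * Complex.I, by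
    have : ((s : ℂ)) * s = -D := by exact_mod_cast hs2
    linear_combination (s : ℂ) * s * Complex.I_mul_I - this⟩
  have hιre : ∀ w : ℤ√D, (ι w).re = w.re := fun w => by simp [ι]
  have hιim : ∀ w : ℤ√D, (ι w).im = w.im * s := fun w => by simp [ι]
  have hιnorm : ∀ w : ℤ√D, ‖ι w‖ ^ 2 = w.norm := by
    intro w
    rw [← Complex.normSq_eq_norm_sq, Complex.normSq_apply, hιre, hιim, Zsqrtd.norm_def]
    push_cast
    linear_combination (w.im : ℝ) * w.im * hs2
  have hιy : ‖ι y‖ = q * S := by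
    rw [← pow_left_inj₀ (norm_nonneg _) (by positivity) two_ne_zero, hιnorm, hy]
  set θ : ℝ := (ι y).arg with hθ
  have hpolar : ∀ k : ℕ, ι (y ^ k) = ((q * S) ^ k : ℝ) * Complex.exp ((k * θ : ℝ) * Complex.I) := by
    intro k
    rw [map_pow, ← Complex.norm_mul_exp_arg_mul_I (ι y), mul_pow, hιy, ← Complex.exp_nat_mul]
    push_cast
    rw [mul_assoc (k : ℂ)]
  have hirr : Irrational (θ / Real.pi) := by
    rintro ⟨r, hr⟩
    apply hne
    have hb : (r.den : ℝ) * θ = r.num * Real.pi := by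
      have h1 : (r : ℝ) * r.den = r.num := by exact_mod_cast Rat.mul_den_eq_num r
      rw [← h1, hr]
      field_simp
    have him : (y ^ r.den).im = 0 := by
      have h1 := hιim (y ^ r.den)
      rw [hpolar, Complex.im_ofReal_mul, Complex.exp_ofReal_mul_I_im, hb,
        Real.sin_int_mul_pi, mul_zero] at h1
      have : ((y ^ r.den).im : ℝ) = 0 := by
        rcases mul_eq_zero.mp h1.symm with h | h
        · exact h
        · linarith
      exact_mod_cast this
    refine zsqrtd_norm_map_eq_of_pow_eq φ (b := r.den) r.den_nz Zsqrtd.norm_one ?_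
    rw [mul_one, ← star_pow]
    ext
    · rw [Zsqrtd.re_star]
    · rw [Zsqrtd.im_star, him, neg_zero]
  -- The linear form `u + v η` is the real part of `c * (u + v √D)`.
  set c : ℂ := ⟨1, -(η / s)⟩ with hc
  have hform : ∀ w : ℤ√D, (w.re : ℝ) + w.im * η = (ι w * c).re := by
    intro w
    rw [Complex.mul_re, hιre, hιim, hc]
    field_simp
    ring
  have hιz : ∀ k, ι (z k) = (2 * D * S ^ k : ℝ) * Complex.exp ((k * θ : ℝ) * Complex.I) := by
    intro k
    have h := congrArg ι (hz k)
    rw [map_mul, map_mul, hpolar, map_pow, map_natCast, map_intCast] at h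
    have h0 : (q : ℂ) ^ k ≠ 0 := pow_ne_zero _ (by exact_mod_cast hq.ne')
    refine mul_left_cancel₀ h0 (h.trans ?_)
    push_cast
    rw [mul_pow]; ring
  have hcosform : ∀ k : ℕ, ((z k).re : ℝ) + (z k).im * η
      = 2 * D * S ^ k * ‖c‖ * Real.cos (k * θ + c.arg) := by
    intro k
    rw [hform, hιz, ← Complex.norm_mul_exp_arg_mul_I c]
    rw [show ((2 * D * S ^ k : ℝ) : ℂ) * Complex.exp ((k * θ : ℝ) * Complex.I) *
      (‖c‖ * Complex.exp (c.arg * Complex.I)) = ((2 * D * S ^ k * ‖c‖ : ℝ) : ℂ) *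
        Complex.exp ((k * θ + c.arg : ℝ) * Complex.I) by
          push_cast; rw [add_mul, Complex.exp_add]; ring]
    rw [Complex.re_ofReal_mul, Complex.exp_ofReal_mul_I_re]
    simp
  have hnormz : ∀ k, ‖ι (z k)‖ = 2 * -D * S ^ k := by
    intro k
    rw [hιz, norm_mul, Complex.norm_exp_ofReal_mul_I, mul_one, Complex.norm_real, Real.norm_eq_abs,
      abs_mul, abs_mul, abs_two, abs_of_neg (by linarith : (D : ℝ) < 0),
      abs_of_pos (by positivity : 0 < S ^ k)]
  have hDpos : (0 : ℝ) < -D := by linarith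
  have hpi := Real.pi_pos
  refine ⟨2 * -D * (‖c‖ * (6 * Real.pi) + 1), S, by positivity, hS, fun N => ?_⟩
  obtain ⟨k, hkN, hk0, l, hkl⟩ :=
    exists_abs_mul_add_le_six_div hirr (c.arg / Real.pi - 1 / 2) N
  have hk0' : (0 : ℝ) < k := by exact_mod_cast hk0
  have hSk : 0 < S ^ k := by positivity
  have hcos : |Real.cos (k * θ + c.arg)| ≤ 6 * Real.pi / k := by
    set e : ℝ := k * (θ / Real.pi) + l + (c.arg / Real.pi - 1 / 2) with he
    have h1 : k * θ + c.arg = e * Real.pi + Real.pi / 2 - l * Real.pi := by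
      rw [he]; field_simp; ring
    rw [h1, Real.cos_sub_int_mul_pi, abs_mul, Real.cos_add_pi_div_two, abs_neg]
    have h2 : |((-1 : ℝ)) ^ l| = 1 := by rw [abs_zpow, abs_neg, abs_one, one_zpow]
    rw [h2, one_mul]
    calc |Real.sin (e * Real.pi)| ≤ |e * Real.pi| := Real.abs_sin_le_abs
      _ = |e| * Real.pi := by rw [abs_mul, abs_of_pos hpi]
      _ ≤ 6 / k * Real.pi := by gcongr
      _ = 6 * Real.pi / k := by ring
  refine ⟨k, hkN, z k, ?_, hφ k, ?_, ?_, ?_⟩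
  · rw [hcosform, abs_mul, abs_mul, abs_mul, abs_mul, abs_two, abs_norm,
      abs_of_neg (by linarith : (D : ℝ) < 0), abs_of_pos hSk]
    calc 2 * -(D : ℝ) * S ^ k * ‖c‖ * |Real.cos (k * θ + c.arg)| * k
        ≤ 2 * -(D : ℝ) * S ^ k * ‖c‖ * (6 * Real.pi / k) * k := by gcongr
      _ = 2 * -(D : ℝ) * (‖c‖ * (6 * Real.pi)) * S ^ k := by field_simp
      _ ≤ _ := by gcongr; linarith
  · rw [← hιre]
    refine (Complex.abs_re_le_norm _).trans ?_
    rw [hnormz]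
    exact mul_le_mul_of_nonneg_right (le_mul_of_one_le_right (by positivity)
      (by linarith [mul_nonneg (norm_nonneg c) hpi.le])) hSk.le
  · have h1 := Complex.abs_im_le_norm (ι (z k))
    rw [hιim, abs_mul, abs_of_pos (by linarith : 0 < s), hnormz] at h1
    have h2 : |((z k).im : ℝ)| ≤ |((z k).im : ℝ)| * s := le_mul_of_one_le_right (abs_nonneg _) hs1
    refine (h2.trans h1).trans ?_
    exact mul_le_mul_of_nonneg_right (le_mul_of_one_le_right (by positivity)
      (by linarith [mul_nonneg (norm_nonneg c) hpi.le])) hSk.le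
  · rw [zsqrtd_norm_powers hq hy (hz k), abs_of_nonneg (by positivity)]
    refine le_mul_of_one_le_left (by positivity) ?_
    nlinarith

/-! ### Real quadratic case -/

/-- Solutions of Pell's equation: units of norm one realising all powers of some `E > 1`. -/
theorem zsqrtd_exists_units {D : ℤ} (hD0 : 0 < D) (hD : ∀ n : ℤ, D ≠ n * n) (ι : ℤ√D →+* ℝ)
    (hι : 0 ≤ ι Zsqrtd.sqrtd) :
    ∃ (E : ℝ) (u : ℤ → ℤ√D), 1 < E ∧ ∀ l, (u l).norm = 1 ∧ ι (u l) = E ^ l ∧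
      ι (star (u l)) = E ^ (-l) := by
  obtain ⟨x, y, hxy, hy⟩ := Pell.exists_of_not_isSquare hD0 (fun ⟨n, hn⟩ => hD n hn)
  let e : ℤ√D := ⟨|x|, |y|⟩
  have he : e.norm = 1 := by
    rw [Zsqrtd.norm_def]
    simp only [e]
    rw [abs_mul_abs_self, mul_assoc, abs_mul_abs_self]
    linarith
  have hιD := zsqrtd_map_sqrtd_mul_self ι
  have hD1 : (1 : ℝ) ≤ D := by exact_mod_cast hD0
  have hy1 : (1 : ℝ) ≤ |(y : ℝ)| := by exact_mod_cast Int.one_le_abs hy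
  have hx1 : (1 : ℝ) ≤ |(x : ℝ)| := by
    have : x ≠ 0 := by
      rintro rfl
      nlinarith [mul_self_nonneg y]
    exact_mod_cast Int.one_le_abs this
  have hE : 1 < ι e := by
    rw [zsqrtd_map_eq]
    simp only [e, Int.cast_abs]
    nlinarith
  have hinv : ι (star e) = (ι e)⁻¹ := by
    have := zsqrtd_map_mul_map_star ι e
    rw [he, Int.cast_one] at this
    exact eq_inv_of_mul_eq_one_right this
  have hu : ∀ l : ℤ, ∃ u : ℤ√D, u.norm = 1 ∧ ι u = (ι e) ^ l ∧ ι (star u) = (ι e) ^ (-l) := by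
    intro l
    have hpow : ∀ (w : ℤ√D) (n : ℕ), w.norm = 1 → (w ^ n).norm = 1 := by
      intro w n hw
      have := map_pow (Zsqrtd.normMonoidHom (d := D)) w n
      simpa [Zsqrtd.normMonoidHom, hw] using this
    rcases Int.eq_nat_or_neg l with ⟨n, rfl | rfl⟩
    · exact ⟨e ^ n, hpow _ _ he, by simp, by simp [hinv]⟩
    · exact ⟨star e ^ n, hpow _ _ (by rw [Zsqrtd.norm_conj, he]), by simp [hinv], by simp⟩
  choose u hu using hu
  exact ⟨ι e, u, hE, hu⟩

/-- For `g₁ g₂ < 0` the form `g₁ exp T + g₂ exp (-T)` is a shifted hyperbolic sine. -/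
theorem exists_eq_mul_exp_of_mul_neg {g₁ g₂ : ℝ} (h : g₁ * g₂ < 0) :
    ∃ G τ : ℝ, g₁ = G * Real.exp τ ∧ g₂ = -(G * Real.exp (-τ)) := by
  have key : ∀ G : ℝ, G * G = -(g₁ * g₂) → 0 < g₁ / G →
      ∃ G τ : ℝ, g₁ = G * Real.exp τ ∧ g₂ = -(G * Real.exp (-τ)) := by
    intro G hG hpos
    have hG0 : G ≠ 0 := by rintro rfl; simp at hpos
    have hg0 : g₁ ≠ 0 := by rintro rfl; simp at hpos
    refine ⟨G, Real.log (g₁ / G), ?_, ?_⟩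
    · rw [Real.exp_log hpos]; field_simp
    · rw [Real.exp_neg, Real.exp_log hpos]
      field_simp
      linear_combination hG
  have hs : 0 < √(-(g₁ * g₂)) := Real.sqrt_pos.mpr (by linarith)
  have hss := Real.mul_self_sqrt (by linarith : 0 ≤ -(g₁ * g₂))
  rcases lt_trichotomy g₁ 0 with h1 | h1 | h1
  · exact key (-√(-(g₁ * g₂))) (by rw [neg_mul_neg, hss]) (div_pos_of_neg_of_neg h1 (by linarith))
  · simp [h1] at h
  · exact key _ hss (div_pos h1 hs)

theorem exp_int_mul_log {E : ℝ} (hE : 0 < E) (l : ℤ) : Real.exp (l * Real.log E) = E ^ l := by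
  rw [mul_comm, Real.exp_mul, Real.exp_log hE, Real.rpow_intCast]

theorem abs_exp_sub_exp_neg_le {x : ℝ} (hx : |x| ≤ 1) :
    |Real.exp x - Real.exp (-x)| ≤ 4 * |x| := by
  have h1 := Real.abs_exp_sub_one_le hx
  have h2 := Real.abs_exp_sub_one_le (x := -x) (by rwa [abs_neg])
  rw [abs_neg] at h2
  calc |Real.exp x - Real.exp (-x)| = |(Real.exp x - 1) - (Real.exp (-x) - 1)| := by ring_nf
    _ ≤ _ := (abs_sub _ _).trans (by linarith)

set_option maxHeartbeats 800000 in
/-- For `D > 0` the two real embeddings of `z k` times the `l`-th power of a unit have quotient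
`exp (2 (k A + l B))` with `A / B` irrational. The linear form `u + v η` vanishes at one
nonzero value of this quotient, so inhomogeneous approximation makes it small once the quotient has
the sign of that value; a further factor `√D` changes this sign where necessary. -/
theorem zsqrtd_exists_small_of_pos {p : ℕ} [Fact p.Prime] {D : ℤ} (φ : ℤ√D →+* ℚ_[p])
    (hD0 : 0 < D) (hD : ∀ n : ℤ, D ≠ n * n) {η : ℝ} (hη : η ^ 2 ≠ D) :
    ∃ C S : ℝ, 0 < C ∧ 1 < S ∧ ∀ N : ℕ, ∃ k ≥ N, ∃ z : ℤ√D,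
      |(z.re : ℝ) + z.im * η| * k ≤ C * S ^ k ∧ ‖φ z‖ * S ^ (2 * k) ≤ 1 ∧
      |(z.re : ℝ)| ≤ C * S ^ k ∧ |(z.im : ℝ)| ≤ C * S ^ k ∧ S ^ (2 * k) ≤ |(z.norm : ℝ)| := by
  obtain ⟨q, S, y, z, hq, hS, hsq, hy, hne, hz, hφ⟩ := zsqrtd_exists_powers φ hD
  have hq' : (0 : ℝ) < q := by exact_mod_cast hq
  have hS0 : 0 < S := by linarith
  have hD1 : (1 : ℝ) ≤ D := by exact_mod_cast hD0
  have hDpos : (0 : ℝ) < D := by linarith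
  set s : ℝ := √(D : ℝ) with hs
  have hs2 : s * s = D := Real.mul_self_sqrt (by linarith)
  have hs1 : 1 ≤ s := Real.one_le_sqrt.mpr hD1
  have hs0 : 0 < s := by linarith
  let ι : ℤ√D →+* ℝ := Zsqrtd.lift ⟨s, hs2⟩
  have hιinj : Function.Injective ι := Zsqrtd.lift_injective _ hD
  have hι : ∀ w : ℤ√D, ι w = w.re + w.im * s := fun w => by simp [ι]
  have hι' : ∀ w : ℤ√D, ι (star w) = w.re - w.im * s := fun w => by
    rw [hι]; simp [sub_eq_add_neg]
  obtain ⟨E, u, hE, hu⟩ := zsqrtd_exists_units hD0 hD ι (by simp [ι]; exact hs0.le)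
  have hlogE : 0 < Real.log E := Real.log_pos hE
  -- The two embeddings of `y / q`.
  set a : ℝ := ι y / q with ha
  set b : ℝ := ι (star y) / q with hb
  have hab : a * b = S ^ 2 := by
    have h := zsqrtd_map_mul_map_star ι y
    rw [hy] at h
    rw [ha, hb, div_mul_div_comm, h]
    field_simp
  have ha0 : 0 < a := by
    have h1 : 0 ≤ a := by
      obtain ⟨w, rfl⟩ := hsq
      rw [ha, map_mul]
      exact div_nonneg (mul_self_nonneg _) hq'.le
    refine lt_of_le_of_ne h1 fun h => ?_
    rw [← h, zero_mul] at hab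
    exact (pow_pos hS0 2).ne hab
  have hb_eq : b = S ^ 2 / a := by rw [← hab]; field_simp
  set θ : ℝ := Real.log (a / S) / Real.log E with hθ
  have haS : 0 < a / S := div_pos ha0 hS0
  have hirr : Irrational θ := by
    rintro ⟨r, hr⟩
    apply hne
    have h1 : (r : ℝ) * r.den = r.num := by exact_mod_cast Rat.mul_den_eq_num r
    have h2 : (r.den : ℝ) * Real.log (a / S) = r.num * Real.log E := by
      rw [← h1, hr, hθ]; field_simp
    have h3 : (a / S) ^ r.den = E ^ r.num := by
      rw [← Real.exp_log haS, ← Real.exp_nat_mul, h2, exp_int_mul_log (by linarith)]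
    refine zsqrtd_norm_map_eq_of_pow_eq φ (b := r.den) r.den_nz (hu (2 * r.num)).1 (hιinj ?_)
    rw [map_mul, map_pow, map_pow, (hu _).2.1]
    have h4 : ι y = q * a := by rw [ha]; field_simp
    have h5 : ι (star y) = q * (S ^ 2 / a) := by rw [← hb_eq, hb]; field_simp
    have h6 : E ^ (2 * r.num) = (a / S) ^ r.den * (a / S) ^ r.den := by
      rw [h3, two_mul, zpow_add₀ (by linarith)]
    rw [h4, h5, h6, ← mul_pow, ← mul_pow]
    congr 1
    field_simp
  have hιz : ∀ k, ι (z k) = 2 * D * a ^ k := by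
    intro k
    have h := congrArg ι (hz k)
    rw [map_mul, map_mul, map_pow, map_pow, map_natCast, map_intCast] at h
    rw [ha, div_pow]
    field_simp
    push_cast at h
    linear_combination h
  have hιz' : ∀ k, ι (star (z k)) = 2 * D * b ^ k := by
    intro k
    have h := congrArg (fun t => ι (star t)) (hz k)
    simp only [star_mul, star_pow, map_mul, map_pow, star_natCast, star_intCast, map_natCast,
      map_intCast] at h
    rw [hb, div_pow]
    field_simp
    push_cast at h
    linear_combination h
  -- The linear form `u + v η` in terms of the two embeddings.
  set c₁ : ℝ := (1 + η / s) / 2 with hc₁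
  set c₂ : ℝ := (1 - η / s) / 2 with hc₂
  have hform : ∀ w : ℤ√D, (w.re : ℝ) + w.im * η = c₁ * ι w + c₂ * ι (star w) := by
    intro w
    rw [hι, hι', hc₁, hc₂]
    field_simp
    ring
  have hcc : c₁ * c₂ ≠ 0 := by
    have : c₁ * c₂ = (D - η ^ 2) / (4 * D) := by
      rw [hc₁, hc₂, ← hs2]; field_simp; ring
    rw [this]
    exact div_ne_zero (sub_ne_zero.mpr hη.symm) (by positivity)
  obtain ⟨γ, hγ1, hγ⟩ : ∃ γ : ℤ√D, (1 : ℝ) ≤ |(γ.norm : ℝ)| ∧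
      (c₁ * ι γ) * (c₂ * ι (star γ)) < 0 := by
    rcases lt_or_gt_of_ne hcc with h | h
    · exact ⟨1, by simp, by simpa using h⟩
    · refine ⟨Zsqrtd.sqrtd, ?_, ?_⟩
      · simp only [Zsqrtd.norm_def, Zsqrtd.re_sqrtd, Zsqrtd.im_sqrtd]
        push_cast
        rw [abs_of_neg] <;> linarith
      · rw [hι, hι']
        simp only [Zsqrtd.re_sqrtd, Zsqrtd.im_sqrtd, Int.cast_zero, Int.cast_one, one_mul]
        nlinarith [mul_pos h hDpos]
  obtain ⟨G, τ, hG1, hG2⟩ := exists_eq_mul_exp_of_mul_neg hγ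
  set M : ℝ := Real.exp (1 + |τ|) with hM
  have hM0 : 0 < M := Real.exp_pos _
  set W : ℝ := max |ι γ| |ι (star γ)| with hW
  have hW0 : 0 ≤ W := le_max_of_le_left (abs_nonneg _)
  refine ⟨2 * D * (|G| * (24 * Real.log E) + W * M + 1), S, by positivity, hS, fun N => ?_⟩
  obtain ⟨k, hkN, hk0, l, hkl⟩ := exists_abs_mul_add_le_six_div hirr (τ / Real.log E)
    (max N ⌈6 * Real.log E⌉₊)
  have hk0' : (0 : ℝ) < k := by exact_mod_cast hk0
  have hkE : 6 * Real.log E ≤ k :=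
    (Nat.le_ceil _).trans (by exact_mod_cast (le_max_right _ _).trans hkN)
  have hSk : 0 < S ^ k := by positivity
  set T : ℝ := k * Real.log (a / S) + l * Real.log E with hT
  have hX : |T + τ| ≤ 6 * Real.log E / k := by
    have : T + τ = (k * θ + l + τ / Real.log E) * Real.log E := by
      rw [hT, hθ]; field_simp
    rw [this, abs_mul, abs_of_pos hlogE]
    calc _ ≤ 6 / (k : ℝ) * Real.log E := by gcongr
      _ = _ := by ring
  have hX1 : |T + τ| ≤ 1 := hX.trans ((div_le_one hk0').mpr hkE)
  have hTabs : |T| ≤ 1 + |τ| := by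
    have := abs_sub (T + τ) τ
    rw [add_sub_cancel_right] at this
    linarith
  have hexpT : Real.exp T = (a / S) ^ k * E ^ l := by
    rw [hT, Real.exp_add, Real.exp_nat_mul, Real.exp_log haS,
      exp_int_mul_log (by linarith)]
  have hexpT' : a ^ k * E ^ l = S ^ k * Real.exp T := by
    rw [hexpT, ← mul_assoc, ← mul_pow, mul_div_cancel₀ _ hS0.ne']
  have hexpT'' : b ^ k * E ^ (-l) = S ^ k * Real.exp (-T) := by
    rw [Real.exp_neg, hexpT, hb_eq, zpow_neg, mul_inv, ← inv_pow, inv_div, ← mul_assoc, ← mul_pow]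
    congr 2
    field_simp
  set w : ℤ√D := γ * z k * u l with hw
  have hw1 : ι w = ι γ * (2 * D * (S ^ k * Real.exp T)) := by
    rw [hw, map_mul, map_mul, hιz, (hu l).2.1, ← hexpT']; ring
  have hw2 : ι (star w) = ι (star γ) * (2 * D * (S ^ k * Real.exp (-T))) := by
    rw [hw, star_mul, star_mul, map_mul, map_mul, hιz', (hu l).2.2, ← hexpT'']; ring
  have hexpM : Real.exp T ≤ M := Real.exp_le_exp.mpr ((le_abs_self T).trans hTabs)
  have hexpM' : Real.exp (-T) ≤ M := Real.exp_le_exp.mpr ((neg_le_abs T).trans hTabs)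
  have hb1 : |ι w| ≤ 2 * D * (W * M) * S ^ k := by
    rw [hw1, abs_mul, abs_of_pos (by positivity : 0 < 2 * (D : ℝ) * (S ^ k * Real.exp T))]
    calc |ι γ| * (2 * D * (S ^ k * Real.exp T)) ≤ W * (2 * D * (S ^ k * M)) := by
          gcongr; exact le_max_left _ _
      _ = _ := by ring
  have hb2 : |ι (star w)| ≤ 2 * D * (W * M) * S ^ k := by
    rw [hw2, abs_mul, abs_of_pos (by positivity : 0 < 2 * (D : ℝ) * (S ^ k * Real.exp (-T)))]
    calc |ι (star γ)| * (2 * D * (S ^ k * Real.exp (-T))) ≤ W * (2 * D * (S ^ k * M)) := by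
          gcongr; exact le_max_right _ _
      _ = _ := by ring
  have hG0 : 0 ≤ |G| * (24 * Real.log E) := by positivity
  have hbC : 2 * D * (W * M) * S ^ k
      ≤ 2 * D * (|G| * (24 * Real.log E) + W * M + 1) * S ^ k := by
    refine mul_le_mul_of_nonneg_right (mul_le_mul_of_nonneg_left ?_ (by positivity)) hSk.le
    linarith
  refine ⟨k, (le_max_left _ _).trans hkN, w, ?_, ?_, ?_, ?_, ?_⟩
  · have h1 : (w.re : ℝ) + w.im * η
        = 2 * D * S ^ k * G * (Real.exp (T + τ) - Real.exp (-(T + τ))) := by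
      rw [hform, hw1, hw2, neg_add T τ, Real.exp_add T τ, Real.exp_add (-T) (-τ)]
      linear_combination (2 * D * (S ^ k * Real.exp T)) * hG1
        + (2 * D * (S ^ k * Real.exp (-T))) * hG2
    rw [h1, abs_mul, abs_mul, abs_of_pos (by positivity : 0 < 2 * (D : ℝ) * S ^ k)]
    have h2 : |Real.exp (T + τ) - Real.exp (-(T + τ))| ≤ 4 * (6 * Real.log E / k) :=
      (abs_exp_sub_exp_neg_le hX1).trans (by linarith)
    calc _ ≤ 2 * D * S ^ k * |G| * (4 * (6 * Real.log E / k)) * k := by gcongr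
      _ = 2 * D * (|G| * (24 * Real.log E)) * S ^ k := by field_simp; ring
      _ ≤ _ := by
        refine mul_le_mul_of_nonneg_right (mul_le_mul_of_nonneg_left ?_ (by positivity)) hSk.le
        linarith [mul_nonneg hW0 hM0.le]
  · have h1 : ‖φ w‖ ≤ ‖φ (z k)‖ := by
      rw [hw, map_mul, map_mul, norm_mul, norm_mul]
      calc _ ≤ 1 * ‖φ (z k)‖ * 1 := by
            gcongr
            · exact zsqrtd_norm_map_le_one φ γ
            · exact zsqrtd_norm_map_le_one φ (u l)
        _ = _ := by ring
    exact (mul_le_mul_of_nonneg_right h1 (by positivity)).trans (hφ k)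
  · refine le_trans ?_ hbC
    have : (w.re : ℝ) = (ι w + ι (star w)) / 2 := by rw [hι, hι']; ring
    rw [this, abs_div, abs_two]
    linarith [abs_add_le (ι w) (ι (star w))]
  · refine le_trans ?_ hbC
    have : (w.im : ℝ) * s = (ι w - ι (star w)) / 2 := by rw [hι, hι']; ring
    have h2 : |(w.im : ℝ)| ≤ |(w.im : ℝ) * s| := by
      rw [abs_mul, abs_of_pos hs0]; exact le_mul_of_one_le_right (abs_nonneg _) hs1
    refine h2.trans ?_
    rw [this, abs_div, abs_two]
    linarith [abs_sub (ι w) (ι (star w))]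
  · have h1 : (w.norm : ℝ) = γ.norm * ((2 * D) ^ 2 * S ^ (2 * k)) := by
      rw [hw, Zsqrtd.norm_mul, Zsqrtd.norm_mul, (hu l).1, mul_one, Int.cast_mul,
        zsqrtd_norm_powers hq hy (hz k)]
    rw [h1, abs_mul, abs_of_pos (by positivity : 0 < (2 * (D : ℝ)) ^ 2 * S ^ (2 * k))]
    have h2 : (1 : ℝ) ≤ (2 * D) ^ 2 := by nlinarith
    calc S ^ (2 * k) ≤ (2 * D) ^ 2 * S ^ (2 * k) := le_mul_of_one_le_left (by positivity) h2
      _ ≤ _ := le_mul_of_one_le_left (by positivity) hγ1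

/-! ### Approximation to `α` and `β` -/

/-- Small values of both linear forms `u + v η` and `φ (u + v √D)`, for any nonsquare `D`. -/
theorem zsqrtd_exists_small {p : ℕ} [Fact p.Prime] {D : ℤ} (φ : ℤ√D →+* ℚ_[p])
    (hD : ∀ n : ℤ, D ≠ n * n) {η : ℝ} (hη : η ^ 2 ≠ D) :
    ∃ C S : ℝ, 0 < C ∧ 1 < S ∧ ∀ N : ℕ, ∃ k ≥ N, ∃ z : ℤ√D,
      |(z.re : ℝ) + z.im * η| * k ≤ C * S ^ k ∧ ‖φ z‖ * S ^ (2 * k) ≤ 1 ∧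
      |(z.re : ℝ)| ≤ C * S ^ k ∧ |(z.im : ℝ)| ≤ C * S ^ k ∧ S ^ (2 * k) ≤ |(z.norm : ℝ)| := by
  rcases lt_trichotomy D 0 with h | h | h
  · exact zsqrtd_exists_small_of_neg φ h η
  · exact absurd h (hD 0)
  · exact zsqrtd_exists_small_of_pos φ h hD hη

theorem abs_fst_le_pairHeight (x : ℤ × ℤ) : |(x.1 : ℝ)| ≤ pairHeight x := le_max_left _ _

theorem abs_snd_le_pairHeight (x : ℤ × ℤ) : |(x.2 : ℝ)| ≤ pairHeight x := le_max_right _ _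

theorem finite_pairHeight_le (M : ℝ) : {x : ℤ × ℤ | pairHeight x ≤ M}.Finite := by
  obtain ⟨m, hm⟩ := exists_nat_ge M
  refine ((Set.finite_Icc (-(m : ℤ)) m).prod (Set.finite_Icc (-(m : ℤ)) m)).subset ?_
  intro x hx
  have h1 := ((abs_fst_le_pairHeight x).trans hx).trans hm
  have h2 := ((abs_snd_le_pairHeight x).trans hx).trans hm
  simp only [Set.mem_prod, Set.mem_Icc]
  exact ⟨abs_le.mp (by exact_mod_cast h1), abs_le.mp (by exact_mod_cast h2)⟩

/-- An infinite set of pairs of integers contains pairs of arbitrarily large height. -/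
theorem exists_lt_pairHeight {T : Set (ℤ × ℤ)} (hT : T.Infinite) (M : ℝ) :
    ∃ x ∈ T, M < pairHeight x := by
  by_contra! h
  exact hT ((finite_pairHeight_le M).subset h)

/-- With `D = b ^ 2 - 4 a c`, the element `u + v √D` gives the pair `(Q, R) = (-2 a v, u + b v)`,
for which `R - Q β = u + v (2 a β + b)`, where `2 a β + b` is a square root of `D` in `ℚ_[p]`. -/
theorem exists_infinite_approx {p : ℕ} [Fact p.Prime] {β : ℚ_[p]} {α : ℝ} {a b c D : ℤ}
    (ha : a ≠ 0) (hβ : (a : ℚ_[p]) * β ^ 2 + b * β + c = 0)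
    (hα : (a : ℝ) * α ^ 2 + b * α + c ≠ 0) (hDdef : D = b ^ 2 - 4 * a * c)
    (hD : ∀ n : ℤ, D ≠ n * n) :
    ∃ C : ℝ, 0 < C ∧
      {x : ℤ × ℤ |
        |(x.1 : ℝ) * α - (x.2 : ℝ)| * Real.log (pairHeight x) ≤ C * pairHeight x ∧
        ‖(x.1 : ℚ_[p]) * β - (x.2 : ℚ_[p])‖ ≤ C * (pairHeight x ^ 2)⁻¹}.Infinite := by
  let φ : ℤ√D →+* ℚ_[p] := Zsqrtd.lift ⟨2 * a * β + b, by
    rw [hDdef]; push_cast; linear_combination 4 * a * hβ⟩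
  have hη : (2 * a * α + b) ^ 2 ≠ (D : ℝ) := by
    intro h
    rw [hDdef] at h
    push_cast at h
    have h1 : (4 * (a : ℝ)) * (a * α ^ 2 + b * α + c) = 0 := by linear_combination h
    rcases mul_eq_zero.mp h1 with h2 | h2
    · exact ha (by exact_mod_cast (by linarith : (a : ℝ) = 0))
    · exact hα h2
  obtain ⟨C, S, hC, hS, hsmall⟩ := zsqrtd_exists_small φ hD hη
  have hS0 : 0 < S := by linarith
  have ha1 : (1 : ℝ) ≤ |(a : ℝ)| := by exact_mod_cast Int.one_le_abs ha
  set A : ℝ := (2 * |(a : ℝ)| + 1 + |(b : ℝ)|) * C with hA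
  have hA0 : 0 < A := by positivity
  set B : ℝ := 1 + |(b : ℝ)| + |(D : ℝ)| with hB
  have hB0 : 0 < B := by positivity
  have hlogS : 0 < Real.log S := Real.log_pos hS
  set L : ℝ := |Real.log A| + Real.log S with hL
  have hL0 : 0 < L := by positivity
  have key : ∀ N : ℕ, ∃ x : ℤ × ℤ, S ^ N ≤ B * pairHeight x ∧
      |(x.1 : ℝ) * α - (x.2 : ℝ)| * Real.log (pairHeight x) ≤ (L * C * B) * pairHeight x ∧
      ‖(x.1 : ℚ_[p]) * β - (x.2 : ℚ_[p])‖ ≤ A ^ 2 * (pairHeight x ^ 2)⁻¹ := by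
    intro N
    obtain ⟨k, hk, z, hz1, hz2, hz3, hz4, hz5⟩ := hsmall (N + 1)
    have hk1 : (1 : ℝ) ≤ k := by exact_mod_cast (by omega : 1 ≤ k)
    have hSk : 0 < S ^ k := by positivity
    set x : ℤ × ℤ := (-2 * a * z.im, z.re + b * z.im) with hx
    set H : ℝ := pairHeight x with hH
    have hx1 : |(-2 : ℝ) * a * z.im| ≤ H := by
      have := abs_fst_le_pairHeight x
      rw [hx] at this; push_cast at this; exact this
    have hx2 : |(z.re : ℝ) + b * z.im| ≤ H := by
      have := abs_snd_le_pairHeight x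
      rw [hx] at this; push_cast at this; exact this
    have hHle : H ≤ A * S ^ k := by
      rw [hH, pairHeight, hx]
      push_cast
      refine max_le ?_ ?_
      · rw [abs_mul, abs_mul, abs_neg, abs_two]
        calc 2 * |(a : ℝ)| * |(z.im : ℝ)| ≤ 2 * |(a : ℝ)| * (C * S ^ k) := by gcongr
          _ ≤ A * S ^ k := by
            rw [hA, mul_assoc _ C]
            refine mul_le_mul_of_nonneg_right ?_ (by positivity)
            linarith [abs_nonneg (b : ℝ)]
      · refine (abs_add_le _ _).trans ?_
        rw [abs_mul]
        calc |(z.re : ℝ)| + |(b : ℝ)| * |(z.im : ℝ)|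
            ≤ C * S ^ k + |(b : ℝ)| * (C * S ^ k) := by gcongr
          _ = (1 + |(b : ℝ)|) * (C * S ^ k) := by ring
          _ ≤ A * S ^ k := by
            rw [hA, mul_assoc _ C]
            refine mul_le_mul_of_nonneg_right ?_ (by positivity)
            linarith [abs_nonneg (a : ℝ)]
    have hH0' : 0 ≤ H := (abs_nonneg _).trans hx1
    have him : |(z.im : ℝ)| ≤ H := by
      refine le_trans ?_ hx1
      rw [abs_mul, abs_mul, abs_neg, abs_two]
      exact le_mul_of_one_le_left (abs_nonneg _) (by linarith)
    have hre : |(z.re : ℝ)| ≤ (1 + |(b : ℝ)|) * H := by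
      have h1 : (z.re : ℝ) = (z.re + b * z.im) - b * z.im := by ring
      rw [h1]
      refine (abs_sub _ _).trans ?_
      rw [abs_mul]
      have : |(b : ℝ)| * |(z.im : ℝ)| ≤ |(b : ℝ)| * H := by gcongr
      linarith
    have hHge : S ^ k ≤ B * H := by
      refine le_of_sq_le_sq ?_ (by positivity)
      rw [← pow_mul, mul_comm k 2]
      refine hz5.trans ?_
      rw [Zsqrtd.norm_def]
      push_cast
      refine (abs_sub _ _).trans ?_
      rw [abs_mul, abs_mul, abs_mul]
      calc |(z.re : ℝ)| * |(z.re : ℝ)| + |(D : ℝ)| * |(z.im : ℝ)| * |(z.im : ℝ)|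
          ≤ ((1 + |(b : ℝ)|) * H) * ((1 + |(b : ℝ)|) * H) + |(D : ℝ)| * H * H := by gcongr
        _ = ((1 + |(b : ℝ)|) ^ 2 + |(D : ℝ)|) * H ^ 2 := by ring
        _ ≤ B ^ 2 * H ^ 2 := by
          refine mul_le_mul_of_nonneg_right ?_ (by positivity)
          rw [hB]
          nlinarith [abs_nonneg (b : ℝ), abs_nonneg (D : ℝ),
            mul_nonneg (abs_nonneg (b : ℝ)) (abs_nonneg (D : ℝ))]
        _ = (B * H) ^ 2 := by ring
    have hH0 : 0 < H := by
      by_contra! h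
      nlinarith
    refine ⟨x, ?_, ?_, ?_⟩
    · exact (pow_le_pow_right₀ hS.le (by omega)).trans hHge
    · have h1 : |(x.1 : ℝ) * α - x.2| = |(z.re : ℝ) + z.im * (2 * a * α + b)| := by
        rw [hx, ← abs_neg]
        push_cast
        congr 1; ring
      have h2 : Real.log H ≤ L * k := by
        refine (Real.log_le_log hH0 hHle).trans ?_
        rw [Real.log_mul hA0.ne' hSk.ne', Real.log_pow, hL]
        have := le_abs_self (Real.log A)
        nlinarith [abs_nonneg (Real.log A)]
      rw [h1]
      calc _ ≤ |(z.re : ℝ) + z.im * (2 * a * α + b)| * (L * k) := by gcongr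
        _ = L * (|(z.re : ℝ) + z.im * (2 * a * α + b)| * k) := by ring
        _ ≤ L * (C * (B * H)) := by
          refine mul_le_mul_of_nonneg_left (hz1.trans ?_) hL0.le
          gcongr
        _ = _ := by ring
    · have h1 : ‖(x.1 : ℚ_[p]) * β - x.2‖ = ‖φ z‖ := by
        rw [← norm_neg, hx]
        simp only [φ, Zsqrtd.lift_apply_apply]
        push_cast
        congr 1; ring
      rw [h1, ← div_eq_mul_inv, le_div_iff₀ (by positivity)]
      calc ‖φ z‖ * H ^ 2 ≤ ‖φ z‖ * (A * S ^ k) ^ 2 := by gcongr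
        _ = A ^ 2 * (‖φ z‖ * S ^ (2 * k)) := by ring
        _ ≤ A ^ 2 * 1 := by gcongr
        _ = A ^ 2 := mul_one _
  refine ⟨L * C * B + A ^ 2, by positivity, fun hfin => ?_⟩
  obtain ⟨M, hM⟩ := (hfin.image pairHeight).bddAbove
  obtain ⟨N, hN⟩ := pow_unbounded_of_one_lt (B * M) hS
  obtain ⟨x, hx1, hx2, hx3⟩ := key N
  have hH0 : 0 ≤ pairHeight x := (abs_nonneg _).trans (abs_fst_le_pairHeight x)
  have hx : pairHeight x ≤ M := by
    refine hM ⟨x, ⟨hx2.trans ?_, hx3.trans ?_⟩, rfl⟩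
    · gcongr; exact le_add_of_nonneg_right (by positivity)
    · gcongr; exact le_add_of_nonneg_left (by positivity)
  have : B * pairHeight x ≤ B * M := by gcongr
  linarith

/-- The `p`-adic absolute value of a nonzero integer `n` is at least of order `1 / |n|`. -/
theorem one_le_mul_padic_norm_int {p : ℕ} [Fact p.Prime] {n : ℤ} (hn : n ≠ 0) :
    1 ≤ p * |(n : ℝ)| * ‖(n : ℚ_[p])‖ := by
  have hp1 : 1 < p := (Fact.out : p.Prime).one_lt
  have hp : (0 : ℝ) < p := by exact_mod_cast (by omega : 0 < p)
  set k := Nat.log p n.natAbs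
  have hlow : p ^ k ≤ n.natAbs := Nat.pow_log_le_self p (Int.natAbs_ne_zero.mpr hn)
  have hndvd : ¬ (p : ℤ) ^ (k + 1) ∣ n := by
    intro h
    have h1 : p ^ (k + 1) ∣ n.natAbs := by
      have := Int.natAbs_dvd_natAbs.mpr h
      rwa [Int.natAbs_pow, Int.natAbs_natCast] at this
    have h2 := Nat.le_of_dvd (Int.natAbs_pos.mpr hn) h1
    exact absurd (Nat.lt_pow_succ_log_self hp1 n.natAbs) (not_lt.mpr h2)
  rw [← Padic.norm_int_le_pow_iff_dvd, not_le, zpow_neg, zpow_natCast] at hndvd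
  have hlow' : (p : ℝ) ^ k ≤ |(n : ℝ)| := by
    rw [← Int.cast_abs, Int.abs_eq_natAbs]
    exact_mod_cast hlow
  calc (1 : ℝ) = p * (p : ℝ) ^ k * ((p : ℝ) ^ (k + 1))⁻¹ := by field_simp; ring
    _ ≤ p * |(n : ℝ)| * ‖(n : ℚ_[p])‖ := by gcongr

/-- Pairs on the coordinate axes with `|Q β - R|_p ≤ C max {|Q|, |R|} ^ (-2)` have bounded
height. -/
theorem mul_ne_zero_of_norm_le {p : ℕ} [Fact p.Prime] {β : ℚ_[p]} (hβ : β ≠ 0) {C : ℝ}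
    {x : ℤ × ℤ} (hx : ‖(x.1 : ℚ_[p]) * β - (x.2 : ℚ_[p])‖ ≤ C * (pairHeight x ^ 2)⁻¹)
    (h0 : 0 < pairHeight x) (h1 : p * C < pairHeight x) (h2 : p * C / ‖β‖ < pairHeight x) :
    x.1 * x.2 ≠ 0 := by
  have hp : (0 : ℝ) < p := by exact_mod_cast (Fact.out : p.Prime).pos
  have hβ0 : 0 < ‖β‖ := norm_pos_iff.mpr hβ
  have hle : ∀ n : ℤ, |(n : ℝ)| = pairHeight x → ∀ t : ℝ, 0 < t →
      ‖(n : ℚ_[p])‖ * t ≤ C * (pairHeight x ^ 2)⁻¹ → t * pairHeight x ≤ p * C := by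
    intro n hn t ht h
    have hn0 : n ≠ 0 := by
      rintro rfl
      rw [Int.cast_zero, abs_zero] at hn
      exact h0.ne hn
    have h3 := one_le_mul_padic_norm_int (p := p) hn0
    rw [hn] at h3
    rw [← div_eq_mul_inv, le_div_iff₀ (by positivity)] at h
    calc t * pairHeight x = t * pairHeight x * 1 := (mul_one _).symm
      _ ≤ t * pairHeight x * (p * pairHeight x * ‖(n : ℚ_[p])‖) := by gcongr
      _ = p * (‖(n : ℚ_[p])‖ * t * pairHeight x ^ 2) := by ring
      _ ≤ p * C := by gcongr
  intro h
  rcases mul_eq_zero.mp h with h | h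
  · have hH : |(x.2 : ℝ)| = pairHeight x := by
      simp [pairHeight, h]
    have := hle x.2 hH 1 one_pos (by simpa [h] using hx)
    linarith
  · have hH : |(x.1 : ℝ)| = pairHeight x := by
      simp [pairHeight, h]
    have := hle x.1 hH ‖β‖ hβ0 (by simpa [h] using hx)
    rw [div_lt_iff₀ hβ0] at h2
    linarith

/-- Multiplying the bounds for the real and for the `p`-adic factor cancels the height. -/
theorem log_mul_multApprox_le {p : ℕ} [Fact p.Prime] {α : ℝ} {β : ℚ_[p]} {C : ℝ} (hC : 0 < C)
    {x : ℤ × ℤ} (h0 : 0 < pairHeight x)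
    (h1 : |(x.1 : ℝ) * α - (x.2 : ℝ)| * Real.log (pairHeight x) ≤ C * pairHeight x)
    (h2 : ‖(x.1 : ℚ_[p]) * β - (x.2 : ℚ_[p])‖ ≤ C * (pairHeight x ^ 2)⁻¹) :
    Real.log (pairHeight x) * multApprox p α β x ≤ C ^ 2 := by
  rw [multApprox]
  calc _ = (|(x.1 : ℝ) * α - (x.2 : ℝ)| * Real.log (pairHeight x)) *
        (pairHeight x * ‖(x.1 : ℚ_[p]) * β - (x.2 : ℚ_[p])‖) := by ring
    _ ≤ (C * pairHeight x) * (pairHeight x * (C * (pairHeight x ^ 2)⁻¹)) := by gcongr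
    _ = C ^ 2 := by field_simp

theorem theorem1p1 (p : ℕ) [Fact p.Prime] (β : ℚ_[p]) (hβ : (minpoly ℚ β).natDegree = 2)
    (f : Polynomial ℤ) (hf : Irreducible f) (hfβ : Polynomial.aeval β f = 0)
    (α : ℝ) (hfα : Polynomial.aeval α f ≠ 0) :
    EKPlus p α β ∧
    Filter.liminf (fun x : ℤ × ℤ =>
        ((Real.log (pairHeight x) * multApprox p α β x : ℝ) : EReal))
      (Filter.comap pairHeight Filter.atTop) < ⊤ ∧
    ∃ C : ℝ, 0 < C ∧
      {x : ℤ × ℤ |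
        |(x.1 : ℝ) * α - (x.2 : ℝ)| * Real.log (pairHeight x) ≤ C * pairHeight x ∧
        ‖(x.1 : ℚ_[p]) * β - (x.2 : ℚ_[p])‖ ≤ C * (pairHeight x ^ 2)⁻¹}.Infinite := by
  have hrat : ∀ r : ℚ, β ≠ r := by
    rintro r rfl
    have h := minpoly.eq_X_sub_C ℚ_[p] r
    rw [eq_ratCast] at h
    rw [h, Polynomial.natDegree_X_sub_C] at hβ
    omega
  have hβ0 : β ≠ 0 := by simpa using hrat 0
  -- By Gauss's lemma `f` has the same degree as the minimal polynomial of `β`.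
  have hdeg0 : f.natDegree ≠ 0 := by
    intro h
    rw [Polynomial.eq_C_of_natDegree_eq_zero h, Polynomial.aeval_C, eq_intCast] at hfβ
    apply hf.ne_zero
    rw [Polynomial.eq_C_of_natDegree_eq_zero h, show f.coeff 0 = 0 by exact_mod_cast hfβ, map_zero]
  have hdeg : f.natDegree = 2 := by
    have hirr := (Polynomial.IsPrimitive.Int.irreducible_iff_irreducible_map_cast
      (hf.isPrimitive hdeg0)).mp hf
    have hroot : Polynomial.aeval β (f.map (Int.castRingHom ℚ)) = 0 := by
      rwa [← algebraMap_int_eq, Polynomial.aeval_map_algebraMap]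
    have h := minpoly.eq_of_irreducible hirr hroot
    rw [← h, Polynomial.natDegree_mul_C (by simpa using hirr.ne_zero),
      Polynomial.natDegree_map_eq_of_injective (RingHom.injective_int _)] at hβ
    exact hβ
  have ha : f.coeff 2 ≠ 0 := by
    rw [← hdeg, Polynomial.coeff_natDegree]
    exact Polynomial.leadingCoeff_ne_zero.mpr hf.ne_zero
  rw [Polynomial.aeval_eq_sum_range, hdeg] at hfβ hfα
  simp only [Finset.sum_range_succ, Finset.sum_range_zero, zero_add, pow_zero, pow_one,
    zsmul_eq_mul, mul_one] at hfβ hfα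
  set a := f.coeff 2
  set b := f.coeff 1
  set c := f.coeff 0
  have hβeq : (a : ℚ_[p]) * β ^ 2 + b * β + c = 0 := by linear_combination hfβ
  have hD : ∀ n : ℤ, b ^ 2 - 4 * a * c ≠ n * n := by
    intro n hn
    have haq : (a : ℚ_[p]) ≠ 0 := by exact_mod_cast ha
    have hn' : ((b : ℚ_[p])) ^ 2 - 4 * a * c = n * n := by exact_mod_cast hn
    have h : (2 * a * β + b - n) * (2 * a * β + b + n) = 0 := by
      linear_combination 4 * (a : ℚ_[p]) * hβeq + hn'
    rcases mul_eq_zero.mp h with h | h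
    · refine hrat ((n - b) / (2 * a)) ?_
      push_cast
      field_simp
      linear_combination h
    · refine hrat ((-n - b) / (2 * a)) ?_
      push_cast
      field_simp
      linear_combination h
  obtain ⟨C, hC, hinf⟩ := exists_infinite_approx (α := α) ha hβeq
    (fun h => hfα (by linear_combination h)) rfl hD
  refine ⟨⟨?_, ?_⟩, ?_, C, hC, hinf⟩
  · rintro _ ⟨x, -, rfl⟩
    have hH : 0 ≤ pairHeight x := (abs_nonneg _).trans (abs_fst_le_pairHeight x)
    exact mul_nonneg (mul_nonneg hH (abs_nonneg _)) (norm_nonneg _)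
  · intro t ht
    refine le_of_forall_pos_le_add fun ε hε => ?_
    rw [zero_add]
    obtain ⟨x, ⟨hx1, hx2⟩, hx⟩ := exists_lt_pairHeight hinf
      (max (max 0 (Real.exp (C ^ 2 / ε))) (max (p * C) (p * C / ‖β‖)))
    simp only [max_lt_iff] at hx
    obtain ⟨⟨hx3, hx4⟩, hx5, hx6⟩ := hx
    refine (ht ⟨x, mul_ne_zero_of_norm_le hβ0 hx2 hx3 hx5 hx6, rfl⟩).trans ?_
    have hlog : C ^ 2 / ε < Real.log (pairHeight x) := (Real.lt_log_iff_exp_lt hx3).mpr hx4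
    have h := log_mul_multApprox_le hC hx3 hx1 hx2
    have hpos : 0 < C ^ 2 / ε := by positivity
    have h' : multApprox p α β x ≤ C ^ 2 / Real.log (pairHeight x) := by
      rw [le_div_iff₀ (hpos.trans hlog)]; linarith
    refine h'.trans ?_
    rw [div_le_iff₀ (hpos.trans hlog)]
    rw [div_lt_iff₀ hε] at hlog
    linarith
  · refine lt_of_le_of_lt (Filter.liminf_le_of_frequently_le' (x := ((C ^ 2 : ℝ) : EReal)) ?_)
      (EReal.coe_lt_top _)
    rw [Filter.frequently_comap, Filter.frequently_atTop]
    intro M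
    obtain ⟨x, ⟨hx1, hx2⟩, hx⟩ := exists_lt_pairHeight hinf (max M 0)
    rw [max_lt_iff] at hx
    exact ⟨pairHeight x, hx.1.le, x, rfl,
      EReal.coe_le_coe_iff.mpr (log_mul_multApprox_le hC hx.2 hx1 hx2)⟩
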